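/- Let $T$ be a ditree: a finite directed graph without loops whose underlying simple graph (join $u\neq v$ by an edge if $(u,v)$ or $(v,u)$ is an arc) is a tree; both arcs $(u,v)$ and $(v,u)$ are allowed to be present. Controllability. Let $\mathcal{Q}(T)$ be the set of real $|T|\times|T|$ matrices $X$ such that, for all $i\neq j$, $X_{ij}\neq 0$ if and only if $(j,i)$ is an arc of $T$ (the diagonal entries are arbitrary). For a set $V_L$ of vertices (the leaders) let $U=U(V;V_L)$ be the matrix whose columns are the standard basis vectors belonging to the vertices in $V_L$. Call $V_L$ controlling if for every $X\in\mathcal{Q}(T)$ the system $\dot x(t)=Xx(t)+Uu(t)$ is controllable, that is, any state can be steered to any other state in finite time by an integrable input. Let $\ell_{\min}(T)$ be the minimum of $|V_L|$ over all controlling sets $V_L$; a controlling set of this size is a minimal leader set. Zero forcing. Color the vertices in a set $Z$ black and all others white, and apply the following rule as long as possible: if a black vertex $u$ has exactly one white out-neighbor $v$, then $v$ becomes black. $Z$ is a zero forcing set if all vertices become black in the end; it is a minimal zero forcing set if no zero forcing set has fewer elements. Path covers. A path in $T$ is a nonempty sequence $(v_1,\dots,v_k)$ of distinct vertices such that $(v_i,v_{i+1})$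 is an arc for $1\le i<k$; its initial point is $v_1$. It is induced if no arc, in either direction, joins two vertices of it that are not consecutive. The path cover number $P(T)$ is the minimum number of pairwise vertex disjoint induced paths that together contain all vertices of $T$; a set of $P(T)$ such paths is a minimal path cover. Then $\ell_{\min}(T)=P(T)$. Moreover, for every minimal path cover of $T$, the set of the initial points of its paths is a minimal zero forcing set, and it is a minimal leader set. All of this holds as well if controllability is understood for the discrete-time systems $x(t+1)=Xx(t)+Uu(t)$, with $\ell_{\min}(T)$ and minimal leader sets defined accordingly. -/

import Mathlib

namespace ZeroForcing

open Matrix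

/-! ### Directed trees -/

/-- A ditree: a digraph without loops whose underlying simple graph is a tree. The arcs are
arbitrary otherwise; in particular both `(u, v)` and `(v, u)` may be present. -/
structure IsDitree {V : Type*} (T : Digraph V) : Prop where
  loopless : ∀ v, ¬ T.Adj v v
  isTree : T.toSimpleGraphInclusive.IsTree

/-! ### Controllability of leader/follower systems -/

/-- Time is continuous or discrete. -/
inductive TimeDomain
  | continuous
  | discrete

section Systems

variable {V : Type*} [Fintype V] {m : Type*} [Fintype m]

/-- `(A, B)` is controllable in continuous time: for all states `x₀`, `x₁` some input `u`,
integrable on `[0, τ]`, gives `ẋ = A x + B u`, `x 0 = x₀` a solution with `x τ = x₁`. A solution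
is a continuous function that satisfies the integrated equation. -/
def ContControllable (A : Matrix V V ℝ) (B : Matrix V m ℝ) : Prop :=
  ∀ x₀ x₁ : V → ℝ, ∃ τ : ℝ, 0 < τ ∧ ∃ (u : ℝ → m → ℝ) (x : ℝ → V → ℝ),
    IntervalIntegrable u MeasureTheory.volume 0 τ ∧
    ContinuousOn x (Set.Icc 0 τ) ∧
    (∀ t ∈ Set.Icc 0 τ, x t = x₀ + ∫ s in (0 : ℝ)..t, (A *ᵥ x s + B *ᵥ u s)) ∧
    x τ = x₁

/-- `(A, B)` is controllable in discrete time: for all states `x₀`, `x₁` some input `u` steers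
`x (t + 1) = A x t + B u t` from `x₀` to `x₁` in finitely many steps. -/
def DiscControllable (A : Matrix V V ℝ) (B : Matrix V m ℝ) : Prop :=
  ∀ x₀ x₁ : V → ℝ, ∃ (N : ℕ) (u : ℕ → m → ℝ) (x : ℕ → V → ℝ),
    x 0 = x₀ ∧ (∀ t, x (t + 1) = A *ᵥ x t + B *ᵥ u t) ∧ x N = x₁

/-- Controllability of the pair `(A, B)` in the given time domain. -/
def PairControllable : TimeDomain → Matrix V V ℝ → Matrix V m ℝ → Prop
  | .continuous => ContControllable
  | .discrete => DiscControllable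

end Systems

section Leaders

variable {V : Type*}

/-- The qualitative class of `G`: the diagonal is free, and an off-diagonal entry `X i j` is
nonzero exactly when `(j, i)` is an arc. -/
def qualitativeClass (G : Digraph V) : Set (Matrix V V ℝ) :=
  {X | ∀ i j, i ≠ j → (X i j ≠ 0 ↔ G.Adj j i)}

variable [DecidableEq V]

/-- The input matrix of a leader set: the columns, indexed by the leaders, are the corresponding
standard basis vectors. -/
def inputMatrix (L : Finset V) : Matrix V {v // v ∈ L} ℝ :=
  Matrix.of fun i j => if i = j.1 then 1 else 0

variable [Fintype V]

/-- `(G; L)` is controllable: every matrix of the qualitative class is controllable from `L`. -/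
def GraphControllable (d : TimeDomain) (G : Digraph V) (L : Finset V) : Prop :=
  ∀ X ∈ qualitativeClass G, PairControllable d X (inputMatrix L)

/-- The minimum number `ℓ_min(G)` of leaders that render `G` controllable. -/
noncomputable def minLeaders (d : TimeDomain) (G : Digraph V) : ℕ :=
  sInf {k | ∃ L : Finset V, GraphControllable d G L ∧ L.card = k}

/-- A leader set of minimum size among those that render `G` controllable. -/
def IsMinimalLeaderSet (d : TimeDomain) (G : Digraph V) (L : Finset V) : Prop :=
  GraphControllable d G L ∧ L.card = minLeaders d G

end Leaders

/-! ### Zero forcing -/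

section Forcing

variable {V : Type*}

/-- `Black G C v`: the vertex `v` lies in the derived set of `C`, that is, `v` becomes black when
the color-change rule is applied as long as possible, starting from the black set `C`. A black
vertex `u` forces its out-neighbor `v` once every other out-neighbor of `u` is black. -/
inductive Black (G : Digraph V) (C : Finset V) : V → Prop
  | init (v : V) : v ∈ C → Black G C v
  | force (u v : V) : Black G C u → G.Adj u v →
      (∀ w, G.Adj u w → w ≠ v → Black G C w) → Black G C v

/-- The derived set of `Z` consists of all vertices. -/
def IsZeroForcingSet (G : Digraph V) (Z : Finset V) : Prop :=
  ∀ v, Black G Z v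

/-- The zero forcing number. -/
noncomputable def zeroForcingNumber (G : Digraph V) : ℕ :=
  sInf {k | ∃ Z : Finset V, IsZeroForcingSet G Z ∧ Z.card = k}

/-- A zero forcing set of minimum size. -/
def IsMinimalZeroForcingSet (G : Digraph V) (Z : Finset V) : Prop :=
  IsZeroForcingSet G Z ∧ Z.card = zeroForcingNumber G

end Forcing

/-! ### Path covers -/

section Paths

variable {V : Type*}

/-- A (directed) path: a nonempty list of distinct vertices with arcs from each one to the next. -/
structure DiPath (G : Digraph V) where
  verts : List V
  ne_nil : verts ≠ []
  nodup : verts.Nodup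
  chain : verts.IsChain G.Adj

/-- The initial point of a path. -/
def DiPath.initial {G : Digraph V} (p : DiPath G) : V := p.verts.head p.ne_nil

/-- The path occurs as an induced subgraph: only consecutive vertices of it are joined by an arc
(in either direction). -/
def DiPath.IsInduced {G : Digraph V} (p : DiPath G) : Prop :=
  ∀ i j : Fin p.verts.length, G.Adj (p.verts.get i) (p.verts.get j) →
    (i : ℕ) + 1 = j ∨ (j : ℕ) + 1 = i

/-- A set of pairwise vertex disjoint induced paths that cover all vertices. -/
structure IsPathCover (G : Digraph V) (P : Finset (DiPath G)) : Prop where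
  induced : ∀ p ∈ P, p.IsInduced
  disjoint : ∀ p ∈ P, ∀ q ∈ P, p ≠ q → List.Disjoint p.verts q.verts
  covers : ∀ v, ∃ p ∈ P, v ∈ p.verts

/-- The path cover number. -/
noncomputable def pathCoverNumber (G : Digraph V) : ℕ :=
  sInf {k | ∃ P : Finset (DiPath G), IsPathCover G P ∧ P.card = k}

/-- A path cover with the minimum number of paths. -/
def IsMinimalPathCover (G : Digraph V) (P : Finset (DiPath G)) : Prop :=
  IsPathCover G P ∧ P.card = pathCoverNumber G

/-- The set of the initial points of a family of paths. -/
def initialPoints [DecidableEq V] {G : Digraph V} (P : Finset (DiPath G)) : Finset V :=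
  P.image DiPath.initial

end Paths

end ZeroForcing

/-! The link between control and paths is zero forcing. For every digraph the controlling sets are
exactly the zero forcing sets (`graphControllable_iff`), in either time domain. If forcing from `L`
stalls, no black vertex has exactly one white out-neighbor, so the entries of some `X` can be
balanced to make the indicator of the white set a left null vector of `[X U]`, which excludes
controllability. Conversely, a functional that annihilates all reachable states yields a family of
functionals that vanishes at the leaders, and this vanishing spreads along the forces
(`IsZeroForcingSet.eq_zero_of_mem`).

In a ditree every path is induced, so the forcing chains of a zero forcing set `Z` are a path cover
with at most `|Z|` paths. Conversely, if the initial points of a path cover did not force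
everything, a walk through the white vertices and their predecessors could go on forever without
backtracking, which a finite tree forbids (`isZeroForcingSet_of_pred`). -/

namespace ZeroForcing

open Matrix

/-! ### Walks in finite trees; induced paths. -/

section Trees

variable {V : Type*}

/-- A finite acyclic graph has no infinite walk without backtracking. -/
theorem exists_backtrack_of_isAcyclic [Finite V] {G : SimpleGraph V} (hG : G.IsAcyclic)
    (a : ℕ → V) (hadj : ∀ n, G.Adj (a n) (a (n + 1))) : ∃ n, a (n + 2) = a n := by
  by_contra! hne
  -- The penultimate vertex is tracked because, by acyclicity, it is the only neighbor of the end
  -- that can lie on the path.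
  have hpath : ∀ n, ∃ p : G.Walk (a 0) (a (n + 1)),
      p.IsPath ∧ p.length = n + 1 ∧ p.penultimate = a n := by
    intro n
    induction n with
    | zero =>
      refine ⟨(hadj 0).toWalk, ?_, by simp, by simp⟩
      simpa using (hadj 0).ne
    | succ n ih =>
      obtain ⟨p, hp, hlen, hpen⟩ := ih
      refine ⟨p.concat (hadj (n + 1)), ?_, by simp [hlen], by simp⟩
      refine hp.concat (fun hmem => ?_) _
      exact hne n ((hG.eq_penultimate_of_adj_end hp (hadj (n + 1)) hmem).trans hpen)
  cases nonempty_fintype V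
  obtain ⟨p, hp, hlen, -⟩ := hpath (Fintype.card V)
  have := hp.length_lt
  omega

theorem IsDitree.adj_toSimpleGraph {T : Digraph V} (hT : IsDitree T) {u v : V}
    (h : T.Adj u v) : T.toSimpleGraphInclusive.Adj u v := by
  refine ⟨fun e => hT.loopless v (e ▸ h), Or.inl h⟩

/-- In a ditree every path is induced. -/
theorem IsDitree.isInduced [Finite V] {T : Digraph V} (hT : IsDitree T) (p : DiPath T) :
    p.IsInduced := by
  have key : ∀ i j : ℕ, ∀ hi : i < p.verts.length, ∀ hj : j < p.verts.length, i + 1 < j →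
      ¬ T.toSimpleGraphInclusive.Adj p.verts[j] p.verts[i] := by
    intro i j hi hj hij hadj
    -- A chord from position `j` to `i` closes a cycle. Running around it has period `j - i + 1 ≥
    -- 3`, so positions two steps apart always differ.
    have hlt : ∀ n : ℕ, i + n % (j - i + 1) < p.verts.length := fun n => by
      have := Nat.mod_lt n (show 0 < j - i + 1 by omega)
      omega
    have hstep : ∀ n, (n % (j - i + 1) = j - i ∧ (n + 1) % (j - i + 1) = 0) ∨
        (n + 1) % (j - i + 1) = n % (j - i + 1) + 1 := fun n => by
      have := Nat.mod_lt n (show 0 < j - i + 1 by omega)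
      rw [← Nat.mod_add_mod n]
      by_cases h : n % (j - i + 1) = j - i
      · exact Or.inl ⟨h, by rw [h, Nat.mod_self]⟩
      · exact Or.inr (Nat.mod_eq_of_lt (by omega))
    obtain ⟨n, hn⟩ := exists_backtrack_of_isAcyclic hT.isTree.isAcyclic
      (fun n => p.verts[i + n % (j - i + 1)]'(hlt n)) (fun n => by
        rcases hstep n with ⟨h1, h2⟩ | h
        · have h3 : i + n % (j - i + 1) = j := by omega
          simp only [h2, h3, add_zero]
          exact hadj
        · simp only [h, ← add_assoc]
          exact hT.adj_toSimpleGraph (List.isChain_iff_getElem.1 p.chain _ _))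
    have := (p.nodup.getElem_inj_iff).1 hn
    rcases hstep n with ⟨h1, h2⟩ | h <;> rcases hstep (n + 1) with ⟨h3, h4⟩ | h' <;>
      simp only [add_assoc, Nat.reduceAdd] at * <;> omega
  intro i j h
  have h' := hT.adj_toSimpleGraph h
  simp only [List.get_eq_getElem] at h'
  have hne : (i : ℕ) ≠ j := fun e => h'.ne (by simp [e])
  by_contra hcon
  rcases lt_or_gt_of_ne hne with hlt | hlt
  · exact key i j i.2 j.2 (by omega) h'.symm
  · exact key j i j.2 i.2 (by omega) h'

end Trees

/-! ### From path covers to zero forcing sets. -/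

section Covers

variable {V : Type*}

/-- Think of `f v` as the vertex preceding `v` on its path. From a white `v` walk to `f v`. If `f v`
is black, it has not forced `v`, so it has another white out-neighbor, whose own predecessor differs
from `f v` by injectivity; walk there. This never backtracks, contrary to
`exists_backtrack_of_isAcyclic`. -/
theorem isZeroForcingSet_of_pred [Finite V] {T : Digraph V} (hT : IsDitree T) (Z : Finset V)
    (f : V → V) (hadj : ∀ v ∉ Z, T.Adj (f v) v)
    (hinj : ∀ v ∉ Z, ∀ w ∉ Z, f v = f w → v = w)
    (hback : ∀ v ∉ Z, f v ∉ Z → f (f v) ≠ v) : IsZeroForcingSet T Z := by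
  classical
  by_contra hZ
  simp only [IsZeroForcingSet, not_forall] at hZ
  obtain ⟨v₀, hv₀⟩ := hZ
  have hnotin : ∀ v, ¬ Black T Z v → v ∉ Z := fun v hv h => hv (.init v h)
  have hother : ∀ u, Black T Z u → (∃ v, ¬ Black T Z v ∧ f v = u) →
      ∃ w, T.Adj u w ∧ ¬ Black T Z w ∧ f w ≠ u := by
    rintro _ hu ⟨v, hv, rfl⟩
    by_contra! hcon
    refine hv (.force (f v) v hu (hadj v (hnotin v hv)) fun w hw hwv => ?_)
    by_contra hwb
    exact hwv (hinj w (hnotin w hwb) v (hnotin v hv) (hcon w hw hwb))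
  choose! o ho using hother
  let g : V → V := fun v => if Black T Z v then o v else f v
  let S : Set V := {v | ¬ Black T Z v ∨ ∃ w, ¬ Black T Z w ∧ f w = v}
  have hgS : ∀ v ∈ S, g v ∈ S ∧ T.toSimpleGraphInclusive.Adj v (g v) ∧ g (g v) ≠ v := by
    intro v hv
    by_cases hb : Black T Z v
    · have hex : ∃ w, ¬ Black T Z w ∧ f w = v := hv.resolve_left (not_not.2 hb)
      obtain ⟨h1, h2, h3⟩ := ho v hb hex
      simp only [g, if_pos hb, if_neg h2]
      exact ⟨Or.inl h2, hT.adj_toSimpleGraph h1, h3⟩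
    · have hvZ := hnotin v hb
      simp only [g, if_neg hb]
      refine ⟨Or.inr ⟨v, hb, rfl⟩, (hT.adj_toSimpleGraph (hadj v hvZ)).symm, ?_⟩
      split_ifs with hfb
      · obtain ⟨h1, h2, h3⟩ := ho (f v) hfb ⟨v, hb, rfl⟩
        intro h
        exact h3 (by rw [h])
      · exact hback v hvZ (hnotin _ hfb)
  have hit : ∀ n, g^[n] v₀ ∈ S := by
    intro n
    induction n with
    | zero => exact Or.inl hv₀
    | succ n ih =>
      rw [Function.iterate_succ_apply']
      exact (hgS _ ih).1
  obtain ⟨n, hn⟩ := exists_backtrack_of_isAcyclic hT.isTree.isAcyclic (fun n => g^[n] v₀)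
    (fun n => by
      simp only [Function.iterate_succ_apply']
      exact (hgS _ (hit n)).2.1)
  simp only [Function.iterate_succ_apply'] at hn
  exact (hgS _ (hit n)).2.2 hn

/-- The initial points of a path cover of a ditree form a zero forcing set. -/
theorem IsPathCover.isZeroForcingSet_initialPoints [Finite V] [DecidableEq V] {T : Digraph V}
    (hT : IsDitree T) {P : Finset (DiPath T)} (hP : IsPathCover T P) :
    IsZeroForcingSet T (initialPoints P) := by
  have hpos : ∀ v, ∃ p ∈ P, ∃ k, ∃ hk : k < p.verts.length, p.verts[k] = v := fun v => by
    obtain ⟨p, hp, hv⟩ := hP.covers v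
    exact ⟨p, hp, List.mem_iff_getElem.1 hv⟩
  choose p hp k hk hpk using hpos
  have huniq : ∀ v w i, ∀ hi : i < (p w).verts.length, (p w).verts[i] = v →
      p v = p w ∧ k v = i := by
    intro v w i hi h
    have hpq : p v = p w := by
      by_contra hne
      refine hP.disjoint _ (hp v) _ (hp w) hne (a := v) ?_ ?_
      · exact List.mem_iff_getElem.2 ⟨_, hk v, hpk v⟩
      · exact List.mem_iff_getElem.2 ⟨_, hi, h⟩
    refine ⟨hpq, ?_⟩
    have h1 := hpk v
    have h2 := hk v
    simp only [hpq] at h1 h2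
    exact ((p w).nodup.getElem_inj_iff).1 (h1.trans h.symm)
  have hk0 : ∀ v ∉ initialPoints P, k v ≠ 0 := by
    intro v hv h0
    refine hv (Finset.mem_image.2 ⟨p v, hp v, ?_⟩)
    have := hpk v
    simp only [h0] at this
    rwa [DiPath.initial, List.head_eq_getElem]
  have hlt : ∀ v, k v - 1 < (p v).verts.length := fun v => lt_of_le_of_lt (Nat.sub_le _ _) (hk v)
  have hpred : ∀ v, p ((p v).verts[k v - 1]'(hlt v)) = p v ∧
      k ((p v).verts[k v - 1]'(hlt v)) = k v - 1 := fun v => huniq _ v _ (hlt v) rfl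
  -- Where `k v = 0` the subtraction truncates and the predecessor is `v` itself; this happens only
  -- at initial points, which the hypotheses exclude.
  refine isZeroForcingSet_of_pred hT _ (fun v => (p v).verts[k v - 1]'(hlt v)) ?_ ?_ ?_
  · intro v hv
    have h0 := hk0 v hv
    have h1 := hk v
    have h := List.isChain_iff_getElem.1 (p v).chain (k v - 1) (by omega)
    have h2 : k v - 1 + 1 = k v := by omega
    simp only [h2, hpk v] at h
    exact h
  · intro v hv w hw h
    have h1 := hpred v
    have h2 := hpred w
    beta_reduce at h
    rw [h] at h1
    have hpe : p v = p w := h1.1.symm.trans h2.1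
    have hke : k v = k w := by
      have := hk0 v hv
      have := hk0 w hw
      omega
    rw [← hpk v, ← hpk w]
    simp only [hpe, hke]
  · intro v hv hfv h
    have h1 := (hpred v).2
    have h2 := (hpred ((p v).verts[k v - 1]'(hlt v))).2
    rw [h] at h2
    have := hk0 v hv
    omega

end Covers

/-! ### From zero forcing sets to path covers. -/

section ForcingChains

variable {V : Type*}

/-- A path extended by a new end point. -/
def DiPath.concat {T : Digraph V} (p : DiPath T) (v : V) (hv : v ∉ p.verts)
    (h : T.Adj (p.verts.getLast p.ne_nil) v) : DiPath T where
  verts := p.verts ++ [v]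
  ne_nil := by simp
  nodup := by
    rw [← List.concat_eq_append]
    exact p.nodup.concat hv
  chain := by
    refine List.isChain_append.2 ⟨p.chain, by simp, ?_⟩
    intro x hx y hy
    rw [List.getLast?_eq_some_getLast p.ne_nil] at hx
    simp only [Option.mem_def, Option.some.injEq, List.head?_cons] at hx hy
    rwa [← hx, ← hy]

/-- The path with a single vertex. -/
def DiPath.single (T : Digraph V) (v : V) : DiPath T where
  verts := [v]
  ne_nil := by simp
  nodup := by simp
  chain := by simp

/-- Disjoint paths on the vertex set `B`, along which forcing has taken place: every vertex that
is not the end of its path has all of its out-neighbors in `B`. -/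
structure IsChainFamily (T : Digraph V) (B : Finset V) (P : Finset (DiPath T)) : Prop where
  disjoint : ∀ p ∈ P, ∀ q ∈ P, p ≠ q → List.Disjoint p.verts q.verts
  mem_iff : ∀ v, v ∈ B ↔ ∃ p ∈ P, v ∈ p.verts
  forced : ∀ p ∈ P, ∀ w ∈ p.verts, w ≠ p.verts.getLast p.ne_nil → ∀ x, T.Adj w x → x ∈ B

/-- Since `u` still has the out-neighbor `v` outside `B`, the field `forced` makes `u` the end of
its path, so `v` can be appended there. -/
theorem IsChainFamily.exists_insert [DecidableEq V] {T : Digraph V} {B : Finset V}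
    {P : Finset (DiPath T)} (h : IsChainFamily T B P) {u v : V} (hu : u ∈ B) (hv : v ∉ B)
    (huv : T.Adj u v) (hother : ∀ w, T.Adj u w → w ≠ v → w ∈ B) :
    ∃ Q : Finset (DiPath T), IsChainFamily T (insert v B) Q ∧ Q.card ≤ P.card := by
  classical
  obtain ⟨p, hp, hup⟩ := (h.mem_iff u).1 hu
  have hlast : u = p.verts.getLast p.ne_nil := by
    by_contra hne
    exact hv (h.forced p hp u hup hne v huv)
  have hvp : ∀ q ∈ P, v ∉ q.verts := fun q hq hvq => hv ((h.mem_iff v).2 ⟨q, hq, hvq⟩)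
  have hadj : T.Adj (p.verts.getLast p.ne_nil) v := hlast ▸ huv
  have hmem : ∀ x, x ∈ (p.concat v (hvp p hp) hadj).verts ↔ x ∈ p.verts ∨ x = v := by
    simp [DiPath.concat]
  have hdisj : ∀ q ∈ P.erase p, List.Disjoint (p.concat v (hvp p hp) hadj).verts q.verts := by
    intro q hq x hx hxq
    obtain ⟨hne, hq⟩ := Finset.mem_erase.1 hq
    rcases (hmem x).1 hx with hx | rfl
    · exact h.disjoint p hp q hq hne.symm hx hxq
    · exact hvp q hq hxq
  refine ⟨insert (p.concat v (hvp p hp) hadj) (P.erase p), ⟨?_, ?_, ?_⟩, ?_⟩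
  · intro q hq r hr hne
    rcases Finset.mem_insert.1 hq with rfl | hq <;> rcases Finset.mem_insert.1 hr with rfl | hr
    · exact absurd rfl hne
    · exact hdisj r hr
    · exact (hdisj q hq).symm
    · exact h.disjoint q (Finset.mem_of_mem_erase hq) r (Finset.mem_of_mem_erase hr) hne
  · intro x
    rw [Finset.mem_insert, h.mem_iff]
    constructor
    · rintro (rfl | ⟨q, hq, hx⟩)
      · exact ⟨_, Finset.mem_insert_self _ _, (hmem x).2 (Or.inr rfl)⟩
      · by_cases hqp : q = p
        · exact ⟨_, Finset.mem_insert_self _ _, (hmem x).2 (Or.inl (hqp ▸ hx))⟩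
        · exact ⟨q, Finset.mem_insert_of_mem (Finset.mem_erase.2 ⟨hqp, hq⟩), hx⟩
    · rintro ⟨q, hq, hx⟩
      rcases Finset.mem_insert.1 hq with rfl | hq
      · exact ((hmem x).1 hx).symm.imp id fun hx => ⟨p, hp, hx⟩
      · exact Or.inr ⟨q, Finset.mem_of_mem_erase hq, hx⟩
  · intro q hq w hw hne x hwx
    rw [Finset.mem_insert]
    rcases Finset.mem_insert.1 hq with rfl | hq
    · rcases (hmem w).1 hw with hw | rfl
      · by_cases hwu : w = u
        · by_cases hxv : x = v
          · exact Or.inl hxv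
          · exact Or.inr (hother x (hwu ▸ hwx) hxv)
        · exact Or.inr (h.forced p hp w hw (hlast ▸ hwu) x hwx)
      · exact absurd (by simp [DiPath.concat]) hne
    · exact Or.inr (h.forced q (Finset.mem_of_mem_erase hq) w hw hne x hwx)
  · refine (Finset.card_insert_le _ _).trans ?_
    rw [Finset.card_erase_of_mem hp]
    have := Finset.card_pos.2 ⟨p, hp⟩
    omega

theorem exists_isChainFamily_self (T : Digraph V) (Z : Finset V) :
    ∃ P : Finset (DiPath T), IsChainFamily T Z P ∧ P.card ≤ Z.card := by
  classical
  refine ⟨Z.image (DiPath.single T), ⟨?_, ?_, ?_⟩, Finset.card_image_le⟩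
  · intro p hp q hq hne
    obtain ⟨v, -, rfl⟩ := Finset.mem_image.1 hp
    obtain ⟨w, -, rfl⟩ := Finset.mem_image.1 hq
    intro x hx hy
    simp only [DiPath.single, List.mem_singleton] at hx hy
    exact hne (by rw [← hx, ← hy])
  · intro v
    simp [DiPath.single]
  · intro p hp w hw hne
    obtain ⟨v, -, rfl⟩ := Finset.mem_image.1 hp
    simp only [DiPath.single, List.mem_singleton, List.getLast_singleton] at hw hne
    exact absurd hw hne

/-- The forcing chains of a zero forcing set `Z` of a ditree form a path cover. -/
theorem IsZeroForcingSet.exists_isPathCover [Finite V] {T : Digraph V} (hT : IsDitree T)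
    {Z : Finset V} (hZ : IsZeroForcingSet T Z) :
    ∃ P : Finset (DiPath T), IsPathCover T P ∧ P.card ≤ Z.card := by
  classical
  -- A maximal `B` avoids choosing an order of the forces: a force leaving `B` would enlarge it.
  obtain ⟨B, -, ⟨hZB, P, hP, hcard⟩, hmax⟩ := Set.Finite.exists_le_maximal (a := Z)
    (Set.toFinite {B : Finset V | Z ⊆ B ∧ ∃ P, IsChainFamily T B P ∧ P.card ≤ Z.card})
    ⟨subset_rfl, exists_isChainFamily_self T Z⟩
  replace hmax : ∀ v, (∃ Q, IsChainFamily T (insert v B) Q ∧ Q.card ≤ Z.card) → v ∈ B :=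
    fun v hQ => hmax ⟨hZB.trans (Finset.subset_insert v B), hQ⟩ (Finset.subset_insert v B)
      (Finset.mem_insert_self v B)
  have hall : ∀ v, v ∈ B := by
    intro v
    induction hZ v with
    | init v hv => exact hZB hv
    | force u v _ huv _ hu hother =>
      by_contra hv
      obtain ⟨Q, hQ, hQP⟩ := hP.exists_insert hu hv huv hother
      exact hv (hmax v ⟨Q, hQ, hQP.trans hcard⟩)
  exact ⟨P, ⟨fun p _ => hT.isInduced p, hP.disjoint, fun v => (hP.mem_iff v).1 (hall v)⟩, hcard⟩

theorem IsZeroForcingSet.pathCoverNumber_le [Finite V] {T : Digraph V} (hT : IsDitree T)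
    {Z : Finset V} (hZ : IsZeroForcingSet T Z) : pathCoverNumber T ≤ Z.card := by
  obtain ⟨P, hP, hcard⟩ := hZ.exists_isPathCover hT
  have h : pathCoverNumber T ≤ P.card := Nat.sInf_le ⟨P, hP, rfl⟩
  exact h.trans hcard

theorem exists_isMinimalPathCover [Fintype V] {T : Digraph V} (hT : IsDitree T) :
    ∃ P : Finset (DiPath T), IsMinimalPathCover T P := by
  obtain ⟨P, hP, -⟩ := IsZeroForcingSet.exists_isPathCover hT (Z := Finset.univ)
    fun v => .init v (Finset.mem_univ v)
  exact Nat.sInf_mem (s := {k | ∃ P : Finset (DiPath T), IsPathCover T P ∧ P.card = k})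
    ⟨_, P, hP, rfl⟩

end ForcingChains

/-! ### Controllability implies zero forcing. -/

section Necessity

variable {V : Type*} [Fintype V]

/-- If a nonempty set of vertices is avoided by `L` and no vertex outside of it has exactly one
out-neighbor in it, then some matrix of the qualitative class has its indicator vector as a left
null vector. -/
theorem exists_vecMul_indicator_eq_zero (G : Digraph V) (W : Set V)
    (hW : ∀ u ∉ W, ∀ v ∈ W, G.Adj u v → ∃ w ∈ W, G.Adj u w ∧ w ≠ v) :
    ∃ X ∈ qualitativeClass G, W.indicator 1 ᵥ* X = 0 := by
  classical
  have hcol : ∀ u, ∃ c : V → ℝ, (∀ i, i ≠ u → (c i ≠ 0 ↔ G.Adj u i)) ∧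
      ∑ i, W.indicator 1 i * c i = 0 := by
    intro u
    -- Each column of `X` must sum to zero over `W`; one entry in `W` is spent on cancelling the
    -- others.
    have hadjust : ∀ (v : V), v ∈ W → ∀ c : V → ℝ,
        ∑ i, W.indicator 1 i * (Function.update c v (-∑ i ∈ Finset.univ.erase v,
          W.indicator 1 i * c i)) i = 0 := by
      intro v hv c
      have hcongr : ∀ r : ℝ, ∑ i ∈ Finset.univ.erase v, W.indicator 1 i * Function.update c v r i =
          ∑ i ∈ Finset.univ.erase v, W.indicator 1 i * c i := fun r =>
        Finset.sum_congr rfl fun i hi => by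
          rw [Function.update_of_ne (Finset.ne_of_mem_erase hi)]
      rw [← Finset.add_sum_erase _ _ (Finset.mem_univ v), hcongr, Function.update_self,
        Set.indicator_of_mem hv, Pi.one_apply, one_mul, neg_add_cancel]
    -- For `u ∈ W` the adjusted entry is the free diagonal one. Otherwise it is the entry of an
    -- out-neighbor `v`, and it is nonzero because a second out-neighbor `w` in `W` contributes `1`
    -- to the sum.
    by_cases hu : u ∈ W
    · refine ⟨_, ?_, hadjust u hu fun i => if G.Adj u i then 1 else 0⟩
      intro i hi
      rw [Function.update_of_ne hi]
      simp
    by_cases hex : ∃ v ∈ W, G.Adj u v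
    · obtain ⟨v, hv, huv⟩ := hex
      obtain ⟨w, hw, huw, hwv⟩ := hW u hu v hv huv
      refine ⟨_, ?_, hadjust v hv fun i => if G.Adj u i then 1 else 0⟩
      intro i hi
      rcases eq_or_ne i v with rfl | hiv
      · rw [Function.update_self]
        refine iff_of_true ?_ huv
        rw [neg_ne_zero]
        refine (Finset.sum_pos' (fun j _ => mul_nonneg ?_ ?_) ⟨w, ?_, ?_⟩).ne'
        · exact Set.indicator_nonneg (fun _ _ => zero_le_one) j
        · split_ifs <;> norm_num
        · exact Finset.mem_erase.2 ⟨hwv, Finset.mem_univ w⟩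
        · simp [hw, huw]
      · rw [Function.update_of_ne hiv]
        simp
    · refine ⟨fun i => if G.Adj u i then 1 else 0, fun i _ => by simp, ?_⟩
      refine Finset.sum_eq_zero fun i _ => ?_
      by_cases hi : i ∈ W
      · simp [show ¬ G.Adj u i from fun h => hex ⟨i, hi, h⟩]
      · simp [hi]
  choose c hc hsum using hcol
  exact ⟨Matrix.of fun i u => c u i, fun i j hij => hc j i hij, funext hsum⟩

/-- A left null vector of `[A B]` is orthogonal to every displacement. -/
theorem ContControllable.eq_zero_of_vecMul_eq_zero {m : Type*} [Fintype m] {A : Matrix V V ℝ}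
    {B : Matrix V m ℝ} (h : ContControllable A B) (z : V → ℝ) (hA : z ᵥ* A = 0)
    (hB : z ᵥ* B = 0) : z = 0 := by
  obtain ⟨τ, hτ, u, x, -, -, hx, h1⟩ := h 0 z
  have hz : z = ∫ s in (0 : ℝ)..τ, (A *ᵥ x s + B *ᵥ u s) := by
    rw [← h1, hx τ ⟨hτ.le, le_rfl⟩, zero_add]
  have hzero : z ⬝ᵥ ∫ s in (0 : ℝ)..τ, (A *ᵥ x s + B *ᵥ u s) = 0 := by
    by_cases hint : IntervalIntegrable (fun s => A *ᵥ x s + B *ᵥ u s) MeasureTheory.volume 0 τ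
    · have := (dotProductBilin ℝ ℝ z).toContinuousLinearMap.intervalIntegral_comp_comm hint
      simpa [dotProduct_add, dotProduct_mulVec, hA, hB, eq_comm] using this
    -- The default value `0` of the integral makes it unnecessary to derive integrability from the
    -- solution.
    · rw [intervalIntegral.integral_undef hint, dotProduct_zero]
  rw [← hz] at hzero
  exact dotProduct_self_eq_zero.1 hzero

theorem DiscControllable.eq_zero_of_vecMul_eq_zero {m : Type*} [Fintype m] {A : Matrix V V ℝ}
    {B : Matrix V m ℝ} (h : DiscControllable A B) (z : V → ℝ) (hA : z ᵥ* A = 0)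
    (hB : z ᵥ* B = 0) : z = 0 := by
  obtain ⟨N, u, x, h0, hx, h1⟩ := h 0 z
  have hzero : z ⬝ᵥ x N = 0 := by
    cases N with
    | zero => rw [h0, dotProduct_zero]
    | succ N => rw [hx, dotProduct_add, dotProduct_mulVec, dotProduct_mulVec, hA, hB,
        zero_dotProduct, zero_dotProduct, add_zero]
  rw [h1] at hzero
  exact dotProduct_self_eq_zero.1 hzero

/-- The leaders of a controllable system form a zero forcing set. -/
theorem GraphControllable.isZeroForcingSet [DecidableEq V] {d : TimeDomain} {G : Digraph V} {L : Finset V}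
    (h : GraphControllable d G L) : IsZeroForcingSet G L := by
  obtain ⟨X, hX, hz⟩ := exists_vecMul_indicator_eq_zero G {v | ¬ Black G L v} (by
    intro u hu v hv huv
    by_contra! hcon
    exact hv (.force u v (not_not.1 hu) huv fun w hw hwv =>
      not_not.1 fun hwb => hwv (hcon w hwb hw)))
  have hB : Set.indicator {v | ¬ Black G L v} 1 ᵥ* inputMatrix L = (0 : {v // v ∈ L} → ℝ) := by
    ext j
    refine Finset.sum_eq_zero fun i _ => ?_
    by_cases hi : i = j.1
    · have : Black G L i := .init i (hi ▸ j.2)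
      simp [this]
    · simp [inputMatrix, hi]
  have hzero : Set.indicator {v | ¬ Black G L v} (1 : V → ℝ) = 0 := by
    cases d with
    | continuous => exact ContControllable.eq_zero_of_vecMul_eq_zero (h X hX) _ hz hB
    | discrete => exact DiscControllable.eq_zero_of_vecMul_eq_zero (h X hX) _ hz hB
  intro v
  by_contra hv
  simpa [hv] using congrFun hzero v

end Necessity

/-! ### Zero forcing implies controllability, and the comparison of minima. -/

section Sufficiency

variable {V : Type*} [DecidableEq V]

theorem mulVec_inputMatrix (L : Finset V) (j : {v // v ∈ L}) (c : ℝ) :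
    inputMatrix L *ᵥ Pi.single j c = Pi.single j.1 c := by
  ext i
  rw [mulVec_single]
  simp [inputMatrix, Pi.single_apply]

variable [Fintype V]

/-- A set of functionals that vanish at the leaders is trivial, provided that it annihilates
`X e_u` whenever it annihilates `e_u`. -/
theorem IsZeroForcingSet.eq_zero_of_mem {G : Digraph V} {L : Finset V}
    (hL : IsZeroForcingSet G L) {X : Matrix V V ℝ} (hX : X ∈ qualitativeClass G)
    {Ψ : Set (Module.Dual ℝ (V → ℝ))}
    (hinit : ∀ v ∈ L, ∀ ψ ∈ Ψ, ψ (Pi.single v 1) = 0)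
    (hstep : ∀ u, (∀ ψ ∈ Ψ, ψ (Pi.single u 1) = 0) → ∀ ψ ∈ Ψ, ψ (X *ᵥ Pi.single u 1) = 0)
    {ψ : Module.Dual ℝ (V → ℝ)} (hψ : ψ ∈ Ψ) : ψ = 0 := by
  have hall : ∀ v, ∀ ψ ∈ Ψ, ψ (Pi.single v 1) = 0 := by
    intro v
    induction hL v with
    | init v hv => exact hinit v hv
    | force u v _ huv _ hu hother =>
      intro ψ hψ
      rcases eq_or_ne v u with rfl | hvu
      · exact hu ψ hψ
      -- Once `ψ` vanishes at `u` and at its other out-neighbors, applying it to column `u` leaves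
      -- only `X v u * ψ e_v`, and `X v u ≠ 0`.
      have hcol : X *ᵥ Pi.single u 1 = ∑ i, X i u • Pi.single i (1 : ℝ) := by
        rw [mulVec_single_one]
        ext i
        simp [Finset.sum_apply, Pi.single_apply]
      have h := hstep u hu ψ hψ
      rw [hcol, map_sum, Finset.sum_eq_single v ?_ (by simp)] at h
      · rw [map_smul, smul_eq_mul] at h
        exact (mul_eq_zero.1 h).resolve_left ((hX v u hvu).2 huv)
      · intro w _ hwv
        rw [map_smul, smul_eq_mul, mul_eq_zero]
        rcases eq_or_ne w u with rfl | hwu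
        · exact Or.inr (hu ψ hψ)
        by_cases hw : X w u = 0
        · exact Or.inl hw
        · exact Or.inr (hother w ((hX w u hwu).1 hw) hwv ψ hψ)
  refine LinearMap.pi_ext' fun v => LinearMap.ext_ring ?_
  simpa using hall v ψ hψ

/-- If `φ` annihilates the range of `Φ`, the functionals `φ ∘ X ^ k` vanish at the leaders, and
replacing `k` by `k + 1` supplies the invariance under `X`. -/
theorem IsZeroForcingSet.discControllable {G : Digraph V} {L : Finset V}
    (hL : IsZeroForcingSet G L) {X : Matrix V V ℝ} (hX : X ∈ qualitativeClass G) :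
    DiscControllable X (inputMatrix L) := by
  let Φ : (ℕ →₀ ({v // v ∈ L} → ℝ)) →ₗ[ℝ] (V → ℝ) :=
    Finsupp.lsum ℝ fun k => (X ^ k * inputMatrix L).mulVecLin
  have hΦ : LinearMap.range Φ = ⊤ := by
    by_contra hne
    obtain ⟨φ, hφ, hker⟩ := Submodule.exists_le_ker_of_lt_top _ (lt_top_iff_ne_top.2 hne)
    refine hφ (hL.eq_zero_of_mem hX
      (Ψ := Set.range fun k : ℕ => φ ∘ₗ (X ^ k).mulVecLin) ?_ ?_ ⟨0, by simp⟩)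
    · rintro v hv _ ⟨k, rfl⟩
      have h := hker (LinearMap.mem_range_self Φ (Finsupp.single k (Pi.single ⟨v, hv⟩ 1)))
      rw [LinearMap.mem_ker] at h
      rw [Finsupp.lsum_single, mulVecLin_apply, ← mulVec_mulVec, mulVec_inputMatrix] at h
      exact h
    · rintro u hu _ ⟨k, rfl⟩
      have h := hu _ ⟨k + 1, rfl⟩
      simpa [pow_succ, ← mulVec_mulVec] using h
  obtain ⟨g, hg⟩ := Φ.exists_rightInverse_of_surjective hΦ
  -- The horizon `N` must not depend on the target, as the target `x₁ - X ^ N *ᵥ x₀` itself depends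
  -- on `N`.
  obtain ⟨N, hN⟩ := Finset.exists_nat_subset_range
    (Finset.univ.biUnion fun i : V => (g (Pi.single i 1)).support)
  have hgN : ∀ z k, N ≤ k → g z k = 0 := by
    intro z k hk
    have hz : z = ∑ i, z i • Pi.single i (1 : ℝ) := by
      ext i
      simp [Finset.sum_apply, Pi.single_apply]
    rw [hz, map_sum, Finsupp.finsetSum_apply]
    refine Finset.sum_eq_zero fun i _ => ?_
    rw [map_smul, Finsupp.smul_apply]
    by_cases h : g (Pi.single i 1) k = 0
    · rw [h, smul_zero]
    · have := hN (Finset.mem_biUnion.2 ⟨i, Finset.mem_univ i, Finsupp.mem_support_iff.2 h⟩)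
      exact absurd (Finset.mem_range.1 this) (by omega)
  intro x₀ x₁
  let w := g (x₁ - X ^ N *ᵥ x₀)
  have hw : ∑ k ∈ Finset.range N, (X ^ k * inputMatrix L) *ᵥ w k = x₁ - X ^ N *ᵥ x₀ := by
    have h : Φ w = x₁ - X ^ N *ᵥ x₀ := LinearMap.congr_fun hg _
    rw [← h, Finsupp.lsum_apply, Finsupp.sum_of_support_subset w (s := Finset.range N)]
    · rfl
    · intro k hk
      by_contra hkN
      exact Finsupp.mem_support_iff.1 hk (hgN _ k (by simpa using hkN))
    · intro k _
      exact map_zero _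
  -- The coefficient of `X ^ k` is the input at time `N - 1 - k`, hence the reversal. Beyond time
  -- `N` the truncated index is harmless: the recursion holds for any input.
  refine ⟨N, fun t => w (N - 1 - t), fun t => X ^ t *ᵥ x₀ + ∑ k ∈ Finset.range t,
    (X ^ (t - 1 - k) * inputMatrix L) *ᵥ w (N - 1 - k), by simp, fun t => ?_, ?_⟩
  · simp only [Finset.sum_range_succ, mulVec_add, mulVec_sum, mulVec_mulVec, ← Matrix.mul_assoc,
      ← pow_succ', add_assoc, Nat.add_sub_cancel, Nat.sub_self, pow_zero, Matrix.one_mul]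
    congr 2
    refine Finset.sum_congr rfl fun k hk => ?_
    rw [show t - 1 - k + 1 = t - k by have := Finset.mem_range.1 hk; omega]
  · simp only
    rw [Finset.sum_range_reflect (fun k => (X ^ k * inputMatrix L) *ᵥ w k), hw]
    abel

/-- Same scheme with the functionals `φ ∘ exp (-s X)` for `0 < s < 1`; differentiation in `s`
replaces the shift of `k`. Continuous inputs on `[0, 1]` suffice. -/
theorem IsZeroForcingSet.contControllable {G : Digraph V} {L : Finset V}
    (hL : IsZeroForcingSet G L) {X : Matrix V V ℝ} (hX : X ∈ qualitativeClass G) :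
    ContControllable X (inputMatrix L) := by
  let A : (V → ℝ) →L[ℝ] (V → ℝ) := X.mulVecLin.toContinuousLinearMap
  let B : ({v // v ∈ L} → ℝ) →L[ℝ] (V → ℝ) := (inputMatrix L).mulVecLin.toContinuousLinearMap
  let E : ℝ → (V → ℝ) →L[ℝ] (V → ℝ) := fun s => NormedSpace.exp (s • A)
  let F : ℝ → (V → ℝ) →L[ℝ] (V → ℝ) := fun s => NormedSpace.exp (s • -A)
  have hE : ∀ s, HasDerivAt E (A * E s) s := hasDerivAt_exp_smul_const' A
  have hF : ∀ s, HasDerivAt F (F s * -A) s := hasDerivAt_exp_smul_const (-A)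
  let _ : NormedAlgebra ℚ ((V → ℝ) →L[ℝ] (V → ℝ)) := NormedAlgebra.restrictScalars ℚ ℝ _
  have hEF : ∀ s, E s * F s = 1 := fun s => by
    have hcomm : Commute (s • A) (s • -A) :=
      ((Commute.refl A).neg_right.smul_left s).smul_right s
    rw [← NormedSpace.exp_add_of_commute hcomm, smul_neg, add_neg_cancel, NormedSpace.exp_zero]
  have hFE : ∀ s, F s * E s = 1 := fun s => by
    have hcomm : Commute (s • -A) (s • A) :=
      ((Commute.refl A).neg_left.smul_left s).smul_right s
    rw [← NormedSpace.exp_add_of_commute hcomm, smul_neg, neg_add_cancel, NormedSpace.exp_zero]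
  have hFc : Continuous F := continuous_iff_continuousAt.2 fun s => (hF s).continuousAt
  have hint : ∀ u : C(ℝ, {v // v ∈ L} → ℝ), Continuous fun s => F s (B (u s)) :=
    fun u => hFc.clm_apply (B.continuous.comp u.continuous)
  let Φ : C(ℝ, {v // v ∈ L} → ℝ) →ₗ[ℝ] (V → ℝ) :=
    { toFun := fun u => ∫ s in (0 : ℝ)..1, F s (B (u s))
      map_add' := fun u u' => by
        simp only [ContinuousMap.add_apply, map_add]
        exact intervalIntegral.integral_add ((hint u).intervalIntegrable _ _)
          ((hint u').intervalIntegrable _ _)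
      map_smul' := fun c u => by
        simp only [ContinuousMap.smul_apply, map_smul, RingHom.id_apply]
        exact intervalIntegral.integral_smul c _ }
  have hΦ : LinearMap.range Φ = ⊤ := by
    by_contra hne
    obtain ⟨φ, hφ, hker⟩ := Submodule.exists_le_ker_of_lt_top _ (lt_top_iff_ne_top.2 hne)
    have hφc : ∀ z, φ z = φ.toContinuousLinearMap z := fun z => rfl
    -- Any point of the open interval would do, since `F s` is invertible; openness is what permits
    -- differentiation.
    have hzero : φ ∘ₗ (F (1 / 2)).toLinearMap = 0 := by
      refine hL.eq_zero_of_mem hX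
        (Ψ := (fun s => φ ∘ₗ (F s).toLinearMap) '' Set.Ioo 0 1) ?_ ?_
        ⟨1 / 2, by norm_num, rfl⟩
      · rintro v hv _ ⟨s, hs, rfl⟩
        by_contra hs0
        let y : ℝ → ℝ := fun s => φ (F s (Pi.single v 1))
        have hy : Continuous y :=
          φ.toContinuousLinearMap.continuous.comp (hFc.clm_apply continuous_const)
        -- Feeding `y` itself into the leader `v` turns `φ (Φ u) = 0` into the vanishing of the
        -- integral of `y ^ 2`.
        let u : C(ℝ, {v // v ∈ L} → ℝ) :=
          ⟨fun s => y s • Pi.single ⟨v, hv⟩ 1, hy.smul continuous_const⟩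
        have hu : ∀ s, φ (F s (B (u s))) = y s * y s := fun s => by
          have : B (u s) = y s • Pi.single v 1 := by
            change B (y s • Pi.single ⟨v, hv⟩ 1) = _
            rw [map_smul]
            exact congrArg _ (mulVec_inputMatrix L ⟨v, hv⟩ 1)
          rw [this, map_smul, map_smul, smul_eq_mul]
        have h := hker (LinearMap.mem_range_self Φ u)
        rw [LinearMap.mem_ker] at h
        change φ (∫ s in (0 : ℝ)..1, F s (B (u s))) = 0 at h
        rw [hφc, ← ContinuousLinearMap.intervalIntegral_comp_comm _
          ((hint u).intervalIntegrable _ _)] at h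
        simp only [← hφc, hu] at h
        exact (intervalIntegral.integral_pos one_pos (hy.mul hy).continuousOn
          (fun r _ => mul_self_nonneg (y r)) ⟨s, Set.Ioo_subset_Icc_self hs, mul_self_pos.2 hs0⟩).ne' h
      · rintro u hu _ ⟨s, hs, rfl⟩
        have hd : HasDerivAt (fun s => φ (F s (Pi.single u 1)))
            (φ.toContinuousLinearMap ((F s * -A) (Pi.single u 1))) s :=
          φ.toContinuousLinearMap.hasFDerivAt.comp_hasDerivAt s
            (by simpa using (hF s).clm_apply (hasDerivAt_const s (Pi.single u (1 : ℝ))))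
        have h0 : (fun s => φ (F s (Pi.single u 1))) =ᶠ[nhds s] fun _ => 0 :=
          Filter.eventually_of_mem (isOpen_Ioo.mem_nhds hs) fun r hr => hu _ ⟨r, hr, rfl⟩
        have h := (hd.congr_of_eventuallyEq h0.symm).unique (hasDerivAt_const s (0 : ℝ))
        have h' : -φ (F s (X *ᵥ Pi.single u 1)) = 0 := by
          rw [← h, ← map_neg, ← map_neg]
          rfl
        exact neg_eq_zero.1 h'
    refine hφ (LinearMap.ext fun z => ?_)
    have h := LinearMap.congr_fun hzero (E (1 / 2) z)
    have h' : F (1 / 2) (E (1 / 2) z) = z := DFunLike.congr_fun (hFE (1 / 2)) z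
    change φ (F (1 / 2) (E (1 / 2) z)) = 0 at h
    rwa [h'] at h
  intro x₀ x₁
  obtain ⟨u, hu⟩ := LinearMap.range_eq_top.1 hΦ (F 1 x₁ - x₀)
  -- Variation of constants; the target `F 1 x₁ - x₀` for `Φ` was chosen so that `x 1 = x₁`.
  let x : ℝ → V → ℝ := fun t => E t (x₀ + ∫ s in (0 : ℝ)..t, F s (B (u s)))
  have hx : ∀ t, HasDerivAt x (X *ᵥ x t + inputMatrix L *ᵥ u t) t := fun t => by
    have hd := (hE t).clm_apply (((hint u).integral_hasStrictDerivAt 0 t).hasDerivAt.const_add x₀)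
    have h' : E t (F t (B (u t))) = B (u t) := DFunLike.congr_fun (hEF t) _
    rw [h'] at hd
    exact hd
  have hxc : Continuous x := continuous_iff_continuousAt.2 fun t => (hx t).continuousAt
  have hx' : Continuous fun t => X *ᵥ x t + inputMatrix L *ᵥ u t :=
    (A.continuous.comp hxc).add (B.continuous.comp u.continuous)
  refine ⟨1, one_pos, u, x, u.continuous.intervalIntegrable _ _, hxc.continuousOn,
    fun t _ => ?_, ?_⟩
  · rw [intervalIntegral.integral_eq_sub_of_hasDerivAt (fun s _ => hx s)
      (hx'.intervalIntegrable _ _)]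
    simp [x, E]
  · change E 1 (x₀ + Φ u) = x₁
    rw [hu, add_sub_cancel]
    exact DFunLike.congr_fun (hEF 1) x₁

theorem IsZeroForcingSet.graphControllable {G : Digraph V} {L : Finset V}
    (hL : IsZeroForcingSet G L) (d : TimeDomain) : GraphControllable d G L := by
  intro X hX
  cases d with
  | continuous => exact hL.contControllable hX
  | discrete => exact hL.discControllable hX

/-- The leader sets that render `G` controllable are the zero forcing sets. -/
theorem graphControllable_iff (d : TimeDomain) (G : Digraph V) (L : Finset V) :
    GraphControllable d G L ↔ IsZeroForcingSet G L :=
  ⟨GraphControllable.isZeroForcingSet, fun h => h.graphControllable d⟩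

theorem minLeaders_eq_zeroForcingNumber (d : TimeDomain) (G : Digraph V) :
    minLeaders d G = zeroForcingNumber G := by
  simp only [minLeaders, zeroForcingNumber, graphControllable_iff]

/-- The cycle of inequalities: zero forcing number ≤ number of initial points ≤ path cover number ≤
zero forcing number. -/
theorem IsMinimalPathCover.isMinimalZeroForcingSet {T : Digraph V} (hT : IsDitree T)
    {P : Finset (DiPath T)} (hP : IsMinimalPathCover T P) :
    IsMinimalZeroForcingSet T (initialPoints P) ∧ zeroForcingNumber T = pathCoverNumber T := by
  have hZ := hP.1.isZeroForcingSet_initialPoints hT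
  have h1 : zeroForcingNumber T ≤ (initialPoints P).card := Nat.sInf_le ⟨_, hZ, rfl⟩
  have h2 : (initialPoints P).card ≤ pathCoverNumber T := Finset.card_image_le.trans hP.2.le
  have h3 : pathCoverNumber T ≤ zeroForcingNumber T := by
    refine le_csInf ⟨_, _, hZ, rfl⟩ ?_
    rintro _ ⟨Z, hZ', rfl⟩
    exact hZ'.pathCoverNumber_le hT
  exact ⟨⟨hZ, by omega⟩, by omega⟩

end Sufficiency

end ZeroForcing

theorem mainTheorem6 {V : Type*} [Fintype V] [DecidableEq V] (T : Digraph V)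
    (hT : ZeroForcing.IsDitree T) :
    (∀ d : ZeroForcing.TimeDomain,
      ZeroForcing.minLeaders d T = ZeroForcing.pathCoverNumber T) ∧
    ∀ P : Finset (ZeroForcing.DiPath T), ZeroForcing.IsMinimalPathCover T P →
      ZeroForcing.IsMinimalZeroForcingSet T (ZeroForcing.initialPoints P) ∧
      ∀ d : ZeroForcing.TimeDomain,
        ZeroForcing.IsMinimalLeaderSet d T (ZeroForcing.initialPoints P) := by
  refine ⟨fun d => ?_, fun P hP => ?_⟩
  · obtain ⟨P, hP⟩ := ZeroForcing.exists_isMinimalPathCover hT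
    rw [ZeroForcing.minLeaders_eq_zeroForcingNumber]
    exact (hP.isMinimalZeroForcingSet hT).2
  · obtain ⟨⟨hZ, hcard⟩, -⟩ := hP.isMinimalZeroForcingSet hT
    exact ⟨⟨hZ, hcard⟩, fun d => ⟨hZ.graphControllable d,
      hcard.trans (ZeroForcing.minLeaders_eq_zeroForcingNumber d T).symm⟩⟩
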